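/- Let $(V,c)$ be a resistance network with at least two vertices: $c_{xy}=c_{yx}\ge 0$, $c_{xx}=0$, $c(x):=\sum_y c_{xy}<\infty$ for every $x\in V$ (infinite degrees are allowed), and any two vertices are joined by a finite chain of edges of positive conductance. Let $p(x,y)=c_{xy}/c(x)$, let $(X_n)_{n\ge 0}$ be the random walk with these transition probabilities, let $\mathbb P_x$ be its law on infinite paths when $X_0=x$, and let $(\Delta v)(x)=\sum_y c_{xy}(v(x)-v(y))$ be the Laplacian. Let $H\subseteq V$ be any nonempty set of vertices, finite or infinite, put $H^\complement = V\setminus H$, and write $\Delta=\begin{pmatrix}A&B^T\\B&D\end{pmatrix}$ in blocks with respect to $H$ and $H^\complement$. The inverse $D^{-1}$ is understood as the entrywise least among the entrywise nonnegative matrices $G$ on $H^\complement$ with $DG=GD=I$ (which is the usual inverse when $H^\complement$ is finite). Then $D^{-1}$ exists and the series for the entries of $B^TD^{-1}B$ converge absolutely, so that the trace (Schur complement) $\mathrm{tr}(\Delta,H)=A-B^TD^{-1}B$ is well defined. Let $c^{\rm tr}_{xy}:=-\mathrm{tr}(\Delta,H)_{xy}$ for $x\ne y$ in $H$ be the conductances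 of the trace network on $H$, and let $p^{\rm tr}(x,y)$, for $x,y\in H$, be the entries of the operator $P^{\rm tr}$ defined by $\mathrm{tr}(\Delta,H)=c\,(I-P^{\rm tr})$, where $c$ is multiplication by the original total conductance $c(x)$; thus $p^{\rm tr}(x,y)=c^{\rm tr}_{xy}/c(x)$ for $x\neq y$. For $x,y\in H$ let $$\mathbb P[x\to y]|_{H^\complement}:=\mathbb P_x\big[\exists\, n\ge 2:\ X_n=y \text{ and } X_i\in H^\complement \text{ for } 0<i<n\big]$$ be the probability that the walk from $x$ reaches $y$ through the complement of $H$, that is, via a path with at least one interior vertex, all of whose interior vertices lie in $H^\complement$. Then $$c^{\rm tr}_{xy}=c_{xy}+c(x)\,\mathbb P[x\to y]|_{H^\complement}\qquad (x,y\in H,\ x\ne y),$$ and consequently $$p^{\rm tr}(x,y)=p(x,y)+\mathbb P[x\to y]|_{H^\complement}\qquad (x,y\in H).$$ Equivalently, including the one-step path in the event, for all $x,y\in H$, $$p^{\rm tr}(x,y)=\mathbb P_x\big[\exists\, n\ge 1:\ X_n=y \text{ and } X_i\in H^\complement \text{ for } 0<i<n\big].$$ -/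

import Mathlib

open MeasureTheory ProbabilityTheory

/-- A resistance network on the vertex set `V`: symmetric nonnegative conductances without loops,
finite total conductance at every vertex (infinite degree is allowed), and connectedness. -/
structure ResistanceNetwork (V : Type*) where
  cond : V → V → ℝ
  nonneg : ∀ x y, 0 ≤ cond x y
  symm : ∀ x y, cond x y = cond y x
  loopless : ∀ x, cond x x = 0
  summable : ∀ x, Summable (cond x)
  connected : ∀ x y, Relation.ReflTransGen (fun a b => 0 < cond a b) x y

namespace ResistanceNetwork

variable {V : Type*} (N : ResistanceNetwork V)

/-- The total conductance `c(x)` at a vertex. -/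
noncomputable def total (x : V) : ℝ := ∑' y, N.cond x y

/-- The transition probabilities `p(x,y) = c_{xy} / c(x)`. -/
noncomputable def prob (x y : V) : ℝ := N.cond x y / N.total x

/-- The network Laplacian `(Δ v)(x) = ∑_y c_{xy} (v x - v y)`. -/
noncomputable def laplacian (v : V → ℝ) (x : V) : ℝ := ∑' y, N.cond x y * (v x - v y)

/-- The matrix of the Laplacian: its `(x,y)` entry is `(Δ δ_y)(x)`. -/
noncomputable def laplacianMatrix : Matrix V V ℝ :=
  Matrix.of fun x y => N.laplacian (Set.indicator {y} 1) x

theorem total_pos [Nontrivial V] (x : V) : 0 < N.total x := by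
  obtain ⟨y, hy⟩ := exists_ne x
  rcases Relation.ReflTransGen.cases_head (N.connected x y) with h | ⟨z, hz, -⟩
  · exact absurd h.symm hy
  · exact lt_of_lt_of_le hz ((N.summable x).le_tsum z fun w _ => N.nonneg x w)

theorem prob_nonneg (x y : V) : 0 ≤ N.prob x y :=
  div_nonneg (N.nonneg x y) (tsum_nonneg fun z => N.nonneg x z)

theorem hasSum_prob [Nontrivial V] (x : V) : HasSum (N.prob x) 1 := by
  have h := (N.summable x).hasSum.div_const (N.total x)
  have h1 : (∑' y, N.cond x y) / N.total x = 1 := div_self (N.total_pos x).ne'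
  rwa [h1] at h

/-- The law of one step of the random walk from `x`: it puts mass `p(x,y)` on `y`. -/
noncomputable def step [Nontrivial V] (x : V) : PMF V :=
  ⟨fun y => ENNReal.ofReal (N.prob x y), by
    rw [ENNReal.summable.hasSum_iff, ← ENNReal.ofReal_tsum_of_nonneg (N.prob_nonneg x)
      (N.hasSum_prob x).summable, (N.hasSum_prob x).tsum_eq, ENNReal.ofReal_one]⟩

variable [MeasurableSpace V] [DiscreteMeasurableSpace V]

/-- The Markov kernel which, given the path up to time `n`, makes one step from its last vertex. -/
noncomputable def stepKernel [Nontrivial V] (n : ℕ) :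
    Kernel ((i : Finset.Iic n) → V) V where
  toFun ω := (N.step (ω ⟨n, Finset.mem_Iic.2 le_rfl⟩)).toMeasure
  measurable' := (Measurable.of_discrete (f := fun x : V => (N.step x).toMeasure)).comp
    (measurable_pi_apply _)

instance [Nontrivial V] (n : ℕ) : IsMarkovKernel (N.stepKernel n) :=
  ⟨fun _ => PMF.toMeasure.isProbabilityMeasure _⟩

/-- The law, on the space of infinite paths, of the random walk started at `x`. -/
noncomputable def walk [Nontrivial V] (x : V) : Measure (ℕ → V) :=
  Kernel.traj (X := fun _ => V) N.stepKernel 0 fun _ => x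

end ResistanceNetwork

/-- The paths that reach `y` at a time `n ≥ 1` and whose vertices strictly between the times
`0` and `n` all lie outside `H` (for `n = 1` there are no such vertices). -/
def pathsAvoiding {V : Type*} (H : Set V) (y : V) : Set (ℕ → V) :=
  {ω | ∃ n, 1 ≤ n ∧ ω n = y ∧ ∀ i, 0 < i → i < n → ω i ∈ Hᶜ}

/-- The paths that reach `y` through the complement of `H`: they reach `y` at a time `n ≥ 2`
and the (at least one) vertices strictly between the times `0` and `n` all lie outside `H`. -/
def pathsThroughCompl {V : Type*} (H : Set V) (y : V) : Set (ℕ → V) :=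
  {ω | ∃ n, 2 ≤ n ∧ ω n = y ∧ ∀ i, 0 < i → i < n → ω i ∈ Hᶜ}

/-- `G` is an entrywise nonnegative two-sided inverse of the possibly infinite matrix `D`, all the
series in the two matrix products being convergent. -/
structure IsNonnegInverse {ι : Type*} (D G : ι → ι → ℝ) : Prop where
  nonneg : ∀ s t, 0 ≤ G s t
  mul_right : ∀ s t, HasSum (fun u => D s u * G u t) (Set.indicator {t} 1 s)
  mul_left : ∀ s t, HasSum (fun u => G s u * D u t) (Set.indicator {t} 1 s)

open Classical in
/-- The inverse `D⁻¹`: the entrywise least nonnegative two-sided inverse of `D`. It is the only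
inverse when `ι` is finite; an infinite `D` can have several. (Junk value `0` if there is none.) -/
noncomputable def minInverse {ι : Type*} (D : ι → ι → ℝ) : ι → ι → ℝ :=
  if h : ∃ G, IsLeast {G | IsNonnegInverse D G} G then h.choose else 0

/-- The Schur complement `A - Bᵀ D⁻¹ B` of a matrix with blocks `A, Bᵀ, B, D` with respect to
`H` and `Hᶜ`. -/
noncomputable def schurComplement {V : Type*} (L : Matrix V V ℝ) (H : Set V) : Matrix H H ℝ :=
  let A := L.toBlock (· ∈ H) (· ∈ H)
  let Bt := L.toBlock (· ∈ H) (· ∈ Hᶜ)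
  let B := L.toBlock (· ∈ Hᶜ) (· ∈ H)
  let D := L.toBlock (· ∈ Hᶜ) (· ∈ Hᶜ)
  Matrix.of fun x y => A x y - ∑' st : ↥Hᶜ × ↥Hᶜ, Bt x st.1 * minInverse D st.1 st.2 * B st.2 y

namespace ResistanceNetwork

variable {V : Type*} (N : ResistanceNetwork V) (H : Set V)

/-- The trace of the Laplacian to `H`. -/
noncomputable def traceLaplacian : Matrix H H ℝ := schurComplement N.laplacianMatrix H

open Classical in
/-- The conductances of the trace network: the negatives of the off-diagonal entries of the
trace of the Laplacian. -/
noncomputable def traceCond (x y : H) : ℝ := if x = y then 0 else -N.traceLaplacian H x y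

/-- The transition probabilities of the trace, that is, the entries of the operator `P^tr` with
`tr(Δ, H) = c (1 - P^tr)`, where `c` is multiplication by the total conductance `c(x)`. -/
noncomputable def traceProb (x y : H) : ℝ :=
  Set.indicator {y} 1 x - N.traceLaplacian H x y / N.total x

end ResistanceNetwork

/-! Let Q be the transition matrix restricted to `Hᶜ` and G = ∑ Qⁿ the Green kernel of the walk
killed on entering `H`. Since D = c(I - Q), the matrix G c⁻¹ inverts D; it is the least nonnegative
inverse because G is the least nonnegative solution of I + Qg ≤ g (`greenKernel_le`,
`greenInverse_le`). Cutting a path from x to y through `Hᶜ` at its first and last interior vertices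
s, t gives it probability ∑ p(x,s) G(s,t) p(t,y) (`walk_pathsThroughCompl_eq_green`). Multiplied by
c(x), this is the entry of BᵀD⁻¹B (`hasSum_schurComplement`). The delicate point is that G is finite
(`green_ne_top`), which rests on connectedness and a hitting probability being at most 1. Sums
therefore live in [0, ∞], where they rearrange freely, until finiteness is known. -/

open scoped ENNReal

/-! ### Powers and Green kernel of a matrix over [0, ∞]. -/

section KernelPowers

variable {ι : Type*} (Q : ι → ι → ℝ≥0∞)

/-- The powers of an infinite matrix with entries in `[0, ∞]`. -/
noncomputable def kernelPow : ℕ → ι → ι → ℝ≥0∞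
  | 0 => fun s t => Set.indicator {t} 1 s
  | n + 1 => fun s t => ∑' u, kernelPow n s u * Q u t

/-- The Green kernel `∑ₙ Qⁿ` of an infinite matrix with entries in `[0, ∞]`. -/
noncomputable def greenKernel (s t : ι) : ℝ≥0∞ := ∑' n, kernelPow Q n s t

theorem tsum_indicator_mul (f : ι → ℝ≥0∞) (s : ι) :
    ∑' u, Set.indicator {u} 1 s * f u = f s := by
  rw [tsum_eq_single s fun u hu => by simp [hu.symm]]
  simp

theorem tsum_mul_indicator (f : ι → ℝ≥0∞) (t : ι) :
    ∑' u, f u * Set.indicator {t} 1 u = f t := by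
  rw [tsum_eq_single t fun u hu => by simp [hu]]
  simp

theorem kernelPow_succ_left (n : ℕ) (s t : ι) :
    kernelPow Q (n + 1) s t = ∑' u, Q s u * kernelPow Q n u t := by
  induction n generalizing t with
  | zero => simp only [kernelPow]; rw [tsum_indicator_mul, tsum_mul_indicator]
  | succ n ih =>
    rw [kernelPow]
    simp_rw [ih, ← ENNReal.tsum_mul_right]
    rw [ENNReal.tsum_comm]
    simp_rw [mul_assoc, ENNReal.tsum_mul_left]
    rfl

theorem greenKernel_eq_add_right (s t : ι) :
    greenKernel Q s t = Set.indicator {t} 1 s + ∑' u, greenKernel Q s u * Q u t := by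
  rw [greenKernel, tsum_eq_zero_add' ENNReal.summable]
  simp_rw [greenKernel, ← ENNReal.tsum_mul_right]
  rw [ENNReal.tsum_comm]
  rfl

theorem greenKernel_eq_add_left (s t : ι) :
    greenKernel Q s t = Set.indicator {t} 1 s + ∑' u, Q s u * greenKernel Q u t := by
  rw [greenKernel, tsum_eq_zero_add' ENNReal.summable]
  simp_rw [greenKernel, ← ENNReal.tsum_mul_left]
  rw [ENNReal.tsum_comm]
  simp_rw [kernelPow_succ_left]
  rfl

/-- Iterating I + Qg ≤ g bounds every partial sum of ∑ Qⁿ by g. -/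
theorem greenKernel_le (g : ι → ι → ℝ≥0∞)
    (hg : ∀ s t, Set.indicator {t} 1 s + ∑' u, Q s u * g u t ≤ g s t) (s t : ι) :
    greenKernel Q s t ≤ g s t := by
  rw [greenKernel, ENNReal.tsum_eq_iSup_nat]
  refine iSup_le fun n => ?_
  induction n generalizing s with
  | zero => simp
  | succ n ih =>
    rw [Finset.sum_range_succ']
    refine le_trans ?_ (hg s t)
    rw [add_comm]
    refine add_le_add le_rfl ?_
    simp_rw [kernelPow_succ_left]
    rw [← Summable.tsum_finsetSum fun _ _ => ENNReal.summable]
    refine ENNReal.tsum_le_tsum fun u => ?_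
    rw [← Finset.mul_sum]
    exact mul_le_mul_right (ih u) _

/-- The right recursion gives G(s,t) Q(t,u) ≤ G(s,u), so finiteness passes backwards along an edge.
-/
theorem greenKernel_ne_top_of_edge {s t u : ι} (hQ : Q t u ≠ 0) (h : greenKernel Q s u ≠ ∞) :
    greenKernel Q s t ≠ ∞ := by
  intro ht
  apply h
  rw [greenKernel_eq_add_right, eq_top_iff]
  refine le_trans ?_ le_add_self
  refine le_trans ?_ (ENNReal.le_tsum t)
  rw [ht, ENNReal.top_mul hQ]

/-- A sequence of functions on `V` driven by a kernel killed off a subset, expressed through the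
powers of the killed kernel. -/
theorem eq_tsum_kernelPow {V : Type*} {S : Set V} (p : V → V → ℝ≥0∞) (a : ℕ → V → ℝ≥0∞)
    (ha : ∀ n y, a (n + 1) y = ∑' z : S, a n z * p z y) (n : ℕ) (t : S) :
    a n t = ∑' s : S, a 0 s * kernelPow (fun u v : S => p u v) n s t := by
  induction n generalizing t with
  | zero => simp only [kernelPow]; rw [tsum_mul_indicator (fun s : S => a 0 s)]
  | succ n ih =>
    rw [ha]
    simp_rw [ih, ← ENNReal.tsum_mul_right]
    rw [ENNReal.tsum_comm]
    simp_rw [mul_assoc, ENNReal.tsum_mul_left]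
    rfl

theorem tsum_eq_tsum_greenKernel {V : Type*} {S : Set V} (p : V → V → ℝ≥0∞) (a : ℕ → V → ℝ≥0∞)
    (ha : ∀ n y, a (n + 1) y = ∑' z : S, a n z * p z y) (y : V) :
    ∑' n, a (n + 1) y =
      ∑' s : S, ∑' t : S, a 0 s * greenKernel (fun u v : S => p u v) s t * p t y := by
  have h : ∀ n, a (n + 1) y = ∑' s : S, ∑' t : S,
      a 0 s * kernelPow (fun u v : S => p u v) n s t * p t y := fun n => by
    rw [ha, ENNReal.tsum_comm]
    refine tsum_congr fun t => ?_
    rw [eq_tsum_kernelPow p a ha n t, ENNReal.tsum_mul_right]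
  simp_rw [h, greenKernel, ← ENNReal.tsum_mul_left, ← ENNReal.tsum_mul_right]
  rw [ENNReal.tsum_comm]
  refine tsum_congr fun s => ?_
  rw [ENNReal.tsum_comm]

end KernelPowers

theorem HasSum.of_real_eq {ι : Type*} {f g : ι → ℝ} {a b : ℝ} (h : HasSum f a)
    (hfg : ∀ i, g i = f i) (hab : b = a) : HasSum g b := by
  rwa [funext hfg, hab]

theorem ENNReal.hasSum_toReal_of_tsum_eq {ι : Type*} {f : ι → ℝ≥0∞} {a : ℝ≥0∞}
    (h : ∑' i, f i = a) (ha : a ≠ ∞) : HasSum (fun i => (f i).toReal) a.toReal := by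
  subst h
  rw [ENNReal.tsum_toReal_eq fun i => ENNReal.ne_top_of_tsum_ne_top ha i]
  exact ENNReal.hasSum_toReal ha

/-! ### Paths sorted by their arrival time. -/

/-- The paths that are at `y` at time `n` and whose vertices strictly between the times `0` and
`n` all lie outside `H`. -/
def pathsAvoidingAt {V : Type*} (H : Set V) (n : ℕ) (y : V) : Set (ℕ → V) :=
  {ω | ω n = y ∧ ∀ i, 0 < i → i < n → ω i ∈ Hᶜ}

theorem measurableSet_pathsAvoidingAt {V : Type*} [MeasurableSpace V]
    [DiscreteMeasurableSpace V] (H : Set V) (n : ℕ) (y : V) :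
    MeasurableSet (pathsAvoidingAt H n y) := by
  have : pathsAvoidingAt H n y =
      (fun ω => ω n) ⁻¹' {y} ∩ ⋂ i, ⋂ _ : 0 < i, ⋂ _ : i < n, (fun ω => ω i) ⁻¹' Hᶜ := by
    ext ω; simp [pathsAvoidingAt]
  rw [this]
  exact ((measurable_pi_apply n) (MeasurableSet.singleton y)).inter
    (.iInter fun i => .iInter fun _ => .iInter fun _ =>
      (measurable_pi_apply i) (MeasurableSet.of_discrete))

/-- A visit to `y ∈ H` at an earlier positive time breaks the avoidance required before a later one.
Hitting probabilities thus become sums over arrival times. -/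
theorem pairwise_disjoint_pathsAvoidingAt {V : Type*} (H : Set V) {y : V} (hy : y ∈ H) :
    Pairwise fun m n => Disjoint (pathsAvoidingAt H (m + 1) y) (pathsAvoidingAt H (n + 1) y) := by
  have key : ∀ m n ω, m < n → ω ∈ pathsAvoidingAt H (m + 1) y →
      ω ∉ pathsAvoidingAt H (n + 1) y := by
    intro m n ω hmn h1 h2
    have := h2.2 (m + 1) (by omega) (by omega)
    rw [h1.1] at this
    exact this hy
  intro m n hmn
  refine Set.disjoint_left.2 fun ω h1 h2 => ?_
  rcases lt_or_gt_of_ne hmn with h | h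
  · exact key m n ω h h1 h2
  · exact key n m ω h h2 h1

namespace ResistanceNetwork

variable {V : Type*} (N : ResistanceNetwork V)

theorem countable_vertices (N : ResistanceNetwork V) : Countable V := by
  classical
  rcases isEmpty_or_nonempty V with h | ⟨⟨x⟩⟩
  · infer_instance
  -- `S n` is the set of endpoints of chains of `n` edges from `x`; summable rows have countable
  -- support. Countability later allows events to be split over the vertex visited at a given time.
  let S : ℕ → Set V := Nat.rec {x} fun _ T => ⋃ a ∈ T, Function.support (N.cond a)
  have hS : ∀ n, (S n).Countable := by
    intro n
    induction n with
    | zero => exact Set.countable_singleton x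
    | succ n ih => exact ih.biUnion fun a _ => (N.summable a).countable_support
  have hx : ∀ y, ∃ n, y ∈ S n := by
    intro y
    induction N.connected x y with
    | refl => exact ⟨0, rfl⟩
    | @tail a b _ hab ih =>
      obtain ⟨n, hn⟩ := ih
      exact ⟨n + 1, Set.mem_biUnion hn hab.ne'⟩
  rw [← Set.countable_univ_iff]
  exact (Set.countable_iUnion hS).mono fun y _ => Set.mem_iUnion.2 (hx y)

/-- The transition probabilities with values in `[0, ∞]`. -/
noncomputable def eprob (x y : V) : ℝ≥0∞ := ENNReal.ofReal (N.prob x y)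

theorem toReal_eprob (x y : V) : (N.eprob x y).toReal = N.prob x y :=
  ENNReal.toReal_ofReal (N.prob_nonneg x y)

open Classical in
theorem laplacianMatrix_apply (x y : V) :
    N.laplacianMatrix x y = (if x = y then N.total x else 0) - N.cond x y := by
  rw [laplacianMatrix, Matrix.of_apply, laplacian]
  by_cases h : x = y
  · subst h
    rw [if_pos rfl, N.loopless, sub_zero, total]
    refine tsum_congr fun z => ?_
    by_cases hz : z = x
    · subst hz; simp [N.loopless]
    · simp [hz]
  · rw [if_neg h, tsum_eq_single y fun z hz => by simp [h, hz]]
    simp [h]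

/-! ### Markov property and path probabilities. -/

section Walk

variable [Nontrivial V] [MeasurableSpace V] [DiscreteMeasurableSpace V] (H : Set V)

instance (x : V) : IsProbabilityMeasure (N.walk x) := by
  unfold walk; infer_instance

theorem stepKernel_apply_singleton (n : ℕ) (w : (i : Finset.Iic n) → V) (y : V) :
    N.stepKernel n w {y} = N.eprob (w ⟨n, Finset.mem_Iic.2 le_rfl⟩) y :=
  PMF.toMeasure_apply_singleton _ _ (MeasurableSet.singleton y)

theorem walk_one (x y : V) : N.walk x {ω | ω 1 = y} = N.eprob x y := by
  have h := congrArg (fun κ => κ (fun _ => x) {y})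
    (Kernel.map_traj_succ_self (X := fun _ : ℕ => V) (κ := N.stepKernel) (a := 0))
  rw [Kernel.map_apply' _ (by fun_prop) _ (MeasurableSet.singleton y),
    N.stepKernel_apply_singleton] at h
  exact h

/-- The Markov property of the walk, for a past event that fixes the present vertex. -/
theorem walk_inter_succ (x y z : V) (n : ℕ) (S : Set ((i : Finset.Iic n) → V))
    (hS : MeasurableSet S) (hz : ∀ w ∈ S, w ⟨n, Finset.mem_Iic.2 le_rfl⟩ = z) :
    N.walk x (Preorder.frestrictLe n ⁻¹' S ∩ {ω | ω (n + 1) = y}) =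
      N.walk x (Preorder.frestrictLe n ⁻¹' S) * N.eprob z y := by
  -- The joint law of the past and the next vertex is a composition product; on `S` its kernel gives
  -- `{y}` the constant mass p(z,y).
  have h := congrArg (fun μ => μ (S ×ˢ {y}))
    (Kernel.partialTraj_compProd_eq_map_traj (X := fun _ : ℕ => V) (κ := N.stepKernel)
      (Nat.zero_le n) (x₀ := fun _ => x))
  rw [Measure.map_apply (by fun_prop) (hS.prod (MeasurableSet.singleton y)),
    Measure.compProd_apply_prod hS (MeasurableSet.singleton y),
    setLIntegral_congr_fun (g := fun _ => N.eprob z y) hS fun w hw => by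
      rw [N.stepKernel_apply_singleton, hz w hw],
    setLIntegral_const, ← Kernel.traj_map_frestrictLe_apply,
    Measure.map_apply (Preorder.measurable_frestrictLe n) hS, mul_comm] at h
  exact h.symm

theorem walk_pathsAvoidingAt_inter_succ (x y z : V) (n : ℕ) :
    N.walk x (pathsAvoidingAt H n z ∩ {ω | ω (n + 1) = y}) =
      N.walk x (pathsAvoidingAt H n z) * N.eprob z y := by
  let S : Set ((i : Finset.Iic n) → V) := (fun w => w ⟨n, Finset.mem_Iic.2 le_rfl⟩) ⁻¹' {z} ∩
    ⋂ i : Finset.Iic n, ⋂ _ : 0 < (i : ℕ), ⋂ _ : (i : ℕ) < n, (fun w => w i) ⁻¹' Hᶜ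
  have hS : MeasurableSet S :=
    MeasurableSet.inter (measurable_pi_apply (⟨n, Finset.mem_Iic.2 le_rfl⟩ : Finset.Iic n)
        (MeasurableSet.singleton z))
      (.iInter fun i => .iInter fun _ => .iInter fun _ =>
        (measurable_pi_apply i) (MeasurableSet.of_discrete (s := Hᶜ)))
  have h : Preorder.frestrictLe n ⁻¹' S = pathsAvoidingAt H n z := by
    ext ω
    simp only [S, pathsAvoidingAt, Set.mem_preimage, Set.mem_inter_iff, Set.mem_singleton_iff,
      Set.mem_ofPred_eq, Set.mem_iInter, Preorder.frestrictLe_apply, Subtype.forall, Finset.mem_Iic]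
    exact and_congr_right fun _ => ⟨fun h i h0 hi => h i hi.le h0 hi, fun h i _ h0 hi => h i h0 hi⟩
  rw [← h]
  exact N.walk_inter_succ x y z n S hS fun w hw => hw.1

theorem walk_pathsAvoidingAt_one (x y : V) :
    N.walk x (pathsAvoidingAt H 1 y) = N.eprob x y := by
  rw [← N.walk_one]
  congr 1
  ext ω
  simp only [pathsAvoidingAt, Set.mem_ofPred_eq, and_iff_left_iff_imp]
  intro _ i h0 h1
  omega

theorem walk_pathsAvoidingAt_succ (x y : V) (n : ℕ) :
    N.walk x (pathsAvoidingAt H (n + 2) y) =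
      ∑' z : ↥Hᶜ, N.walk x (pathsAvoidingAt H (n + 1) z) * N.eprob z y := by
  have := N.countable_vertices
  have h : pathsAvoidingAt H (n + 2) y =
      ⋃ z : ↥Hᶜ, pathsAvoidingAt H (n + 1) (z : V) ∩ {ω | ω (n + 1 + 1) = y} := by
    ext ω
    simp only [pathsAvoidingAt, Set.mem_iUnion, Set.mem_inter_iff, Set.mem_ofPred_eq]
    constructor
    · rintro ⟨hy, hω⟩
      exact ⟨⟨ω (n + 1), hω _ (by omega) (by omega)⟩,
        ⟨rfl, fun i h0 hi => hω i h0 (by omega)⟩, hy⟩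
    · rintro ⟨z, ⟨hz, hω⟩, hy⟩
      refine ⟨hy, fun i h0 hi => ?_⟩
      rcases Nat.lt_succ_iff_lt_or_eq.1 hi with hi | rfl
      · exact hω i h0 hi
      · rw [hz]; exact z.2
  rw [h, measure_iUnion]
  · exact tsum_congr fun z => N.walk_pathsAvoidingAt_inter_succ H x y z (n + 1)
  · intro z z' hzz'
    refine Set.disjoint_left.2 fun ω hω hω' => hzz' (Subtype.ext ?_)
    exact hω.1.1.symm.trans hω'.1.1
  · exact fun z => (measurableSet_pathsAvoidingAt H _ _).inter
      (measurableSet_eq_fun (measurable_pi_apply (n + 1 + 1)) measurable_const)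

theorem walk_pathsAvoiding {y : V} (hy : y ∈ H) (x : V) :
    N.walk x (pathsAvoiding H y) = ∑' n, N.walk x (pathsAvoidingAt H (n + 1) y) := by
  rw [← measure_iUnion (pairwise_disjoint_pathsAvoidingAt H hy)
    fun n => measurableSet_pathsAvoidingAt H _ _]
  congr 1
  ext ω
  simp only [pathsAvoiding, pathsAvoidingAt, Set.mem_iUnion, Set.mem_ofPred_eq]
  constructor
  · rintro ⟨n, hn, h⟩
    obtain ⟨m, rfl⟩ := Nat.exists_eq_add_of_le' hn
    exact ⟨m, h⟩
  · rintro ⟨n, h⟩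
    exact ⟨n + 1, by omega, h⟩

theorem walk_pathsThroughCompl {y : V} (hy : y ∈ H) (x : V) :
    N.walk x (pathsThroughCompl H y) = ∑' n, N.walk x (pathsAvoidingAt H (n + 2) y) := by
  rw [← measure_iUnion (f := fun n => pathsAvoidingAt H (n + 2) y)
    (fun m n hmn => pairwise_disjoint_pathsAvoidingAt H hy (by simpa using hmn : m + 1 ≠ n + 1))
    fun n => measurableSet_pathsAvoidingAt H _ _]
  congr 1
  ext ω
  simp only [pathsThroughCompl, pathsAvoidingAt, Set.mem_iUnion, Set.mem_ofPred_eq]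
  constructor
  · rintro ⟨n, hn, h⟩
    obtain ⟨m, rfl⟩ := Nat.exists_eq_add_of_le' hn
    exact ⟨m, h⟩
  · rintro ⟨n, h⟩
    exact ⟨n + 2, by omega, h⟩

theorem walk_pathsAvoiding_eq_add {y : V} (hy : y ∈ H) (x : V) :
    N.walk x (pathsAvoiding H y) = N.eprob x y + N.walk x (pathsThroughCompl H y) := by
  rw [N.walk_pathsAvoiding H hy, N.walk_pathsThroughCompl H hy,
    tsum_eq_zero_add' ENNReal.summable, zero_add, N.walk_pathsAvoidingAt_one]

end Walk

/-! ### Green function of the killed walk and the inverse of D. -/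

section Green

variable (H : Set V)

/-- The Green function of the walk killed on `H`. -/
noncomputable def green (s t : ↥Hᶜ) : ℝ≥0∞ :=
  greenKernel (fun u v : ↥Hᶜ => N.eprob u v) s t

theorem walk_pathsThroughCompl_eq_green [Nontrivial V] [MeasurableSpace V]
    [DiscreteMeasurableSpace V] {y : V} (hy : y ∈ H) (x : V) :
    N.walk x (pathsThroughCompl H y) =
      ∑' st : ↥Hᶜ × ↥Hᶜ, N.eprob x st.1 * N.green H st.1 st.2 * N.eprob st.2 y := by
  rw [N.walk_pathsThroughCompl H hy, ENNReal.tsum_prod']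
  refine (tsum_eq_tsum_greenKernel N.eprob (fun n y => N.walk x (pathsAvoidingAt H (n + 1) y))
    (fun n y => N.walk_pathsAvoidingAt_succ H x y n) y).trans ?_
  simp_rw [zero_add, N.walk_pathsAvoidingAt_one]
  rfl

/-- For a walk started in `Hᶜ`, the sum is the probability that it enters `H` at `y`. -/
theorem tsum_green_mul_eprob_le_one [Nontrivial V] [MeasurableSpace V]
    [DiscreteMeasurableSpace V] {y : V} (hy : y ∈ H) (s : ↥Hᶜ) :
    ∑' t : ↥Hᶜ, N.green H s t * N.eprob t y ≤ 1 := by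
  have hδ : ∀ u : ↥Hᶜ, (Set.indicator {(u : V)} 1 (s : V) : ℝ≥0∞) =
      Set.indicator {u} 1 s := fun u => by
    by_cases hu : s = u <;> simp [hu, Subtype.coe_inj]
  -- Index 0 is the point mass at `s`, so that summing the recursion from index 1 leaves the single
  -- row G(s, ·).
  let a : ℕ → V → ℝ≥0∞ := fun n z => match n with
    | 0 => Set.indicator {z} 1 (s : V)
    | n + 1 => N.walk s (pathsAvoidingAt H (n + 1) z)
  have ha : ∀ n z, a (n + 1) z = ∑' u : ↥Hᶜ, a n u * N.eprob u z := by
    intro n z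
    cases n with
    | zero =>
      simp only [a, hδ]
      rw [tsum_indicator_mul (fun u : ↥Hᶜ => N.eprob u z), zero_add, N.walk_pathsAvoidingAt_one]
    | succ n => exact N.walk_pathsAvoidingAt_succ H s z n
  have h := tsum_eq_tsum_greenKernel N.eprob a ha y
  simp only [a, hδ, mul_assoc, ENNReal.tsum_mul_left] at h
  rw [tsum_indicator_mul (fun u : ↥Hᶜ => ∑' t : ↥Hᶜ,
    greenKernel (fun u v : ↥Hᶜ => N.eprob u v) u t * N.eprob t y),
    ← N.walk_pathsAvoiding H hy] at h
  exact h.symm.trans_le prob_le_one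

theorem eprob_ne_zero [Nontrivial V] {x y : V} (h : 0 < N.cond x y) : N.eprob x y ≠ 0 := by
  rw [eprob, Ne, ENNReal.ofReal_eq_zero, not_le]
  exact div_pos h (N.total_pos x)

/-- Induct along a chain from `t` to a vertex of `H`: an edge into `H` bounds G(s,t) by the hitting
estimate, and an edge inside `Hᶜ` transfers finiteness from its far end. -/
theorem green_ne_top [Nontrivial V] (hH : H.Nonempty) (s t : ↥Hᶜ) : N.green H s t ≠ ∞ := by
  -- The bound comes from the path measure, though finiteness itself involves no σ-algebra.
  let _ : MeasurableSpace V := ⊤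
  obtain ⟨y, hy⟩ := hH
  obtain ⟨t, ht⟩ := t
  induction N.connected t y using Relation.ReflTransGen.head_induction_on with
  | refl => exact absurd hy ht
  | @head t u htu _ ih =>
    by_cases hu : u ∈ H
    · intro htop
      have h := (ENNReal.le_tsum (f := fun t : ↥Hᶜ => N.green H s t * N.eprob t u) ⟨t, ht⟩).trans
        (N.tsum_green_mul_eprob_le_one H hu s)
      simp only [htop, ENNReal.top_mul (N.eprob_ne_zero htu)] at h
      exact absurd h (by simp)
    · exact greenKernel_ne_top_of_edge (fun u v : ↥Hᶜ => N.eprob u v) (t := ⟨t, ht⟩) (u := ⟨u, hu⟩)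
        (N.eprob_ne_zero htu) (ih hu)

theorem hasSum_prob_mul_green [Nontrivial V] (hH : H.Nonempty) (s t : ↥Hᶜ) :
    HasSum (fun u : ↥Hᶜ => N.prob s u * (N.green H u t).toReal)
      ((N.green H s t).toReal - Set.indicator {t} 1 s) := by
  have h := greenKernel_eq_add_left (fun u v : ↥Hᶜ => N.eprob u v) s t
  change N.green H s t = _ + ∑' u : ↥Hᶜ, N.eprob s u * N.green H u t at h
  have hfin : ∑' u : ↥Hᶜ, N.eprob s u * N.green H u t ≠ ∞ :=
    ne_top_of_le_ne_top (N.green_ne_top H hH s t) (h ▸ le_add_self)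
  have h' := ENNReal.hasSum_toReal_of_tsum_eq rfl hfin
  simp only [ENNReal.toReal_mul, toReal_eprob] at h'
  refine h'.of_real_eq (fun _ => rfl) ?_
  by_cases hst : s = t
  · rw [h, ENNReal.toReal_add (by simp [hst]) hfin]; simp [hst]
  · rw [h, ENNReal.toReal_add (by simp [hst]) hfin]; simp [hst]

theorem hasSum_green_mul_prob [Nontrivial V] (hH : H.Nonempty) (s t : ↥Hᶜ) :
    HasSum (fun u : ↥Hᶜ => (N.green H s u).toReal * N.prob u t)
      ((N.green H s t).toReal - Set.indicator {t} 1 s) := by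
  have h := greenKernel_eq_add_right (fun u v : ↥Hᶜ => N.eprob u v) s t
  change N.green H s t = _ + ∑' u : ↥Hᶜ, N.green H s u * N.eprob u t at h
  have hfin : ∑' u : ↥Hᶜ, N.green H s u * N.eprob u t ≠ ∞ :=
    ne_top_of_le_ne_top (N.green_ne_top H hH s t) (h ▸ le_add_self)
  have h' := ENNReal.hasSum_toReal_of_tsum_eq rfl hfin
  simp only [ENNReal.toReal_mul, toReal_eprob] at h'
  refine h'.of_real_eq (fun _ => rfl) ?_
  by_cases hst : s = t
  · rw [h, ENNReal.toReal_add (by simp [hst]) hfin]; simp [hst]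
  · rw [h, ENNReal.toReal_add (by simp [hst]) hfin]; simp [hst]

theorem total_mul_prob [Nontrivial V] (x y : V) : N.total x * N.prob x y = N.cond x y :=
  mul_div_cancel₀ _ (N.total_pos x).ne'

theorem laplacianMatrix_compl_apply [Nontrivial V] (s t : ↥Hᶜ) :
    N.laplacianMatrix.toBlock (· ∈ Hᶜ) (· ∈ Hᶜ) s t =
      N.total s * (Set.indicator {t} 1 s - N.prob s t) := by
  classical
  rw [Matrix.toBlock_apply, laplacianMatrix_apply, mul_sub, total_mul_prob]
  by_cases h : s = t <;> simp [h, Subtype.coe_inj]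

theorem laplacianMatrix_of_ne {x y : V} (h : x ≠ y) : N.laplacianMatrix x y = -N.cond x y := by
  classical
  rw [laplacianMatrix_apply, if_neg h, zero_sub]

/-- The Green function divided by the total conductance: the inverse of the Laplacian on `Hᶜ`. -/
noncomputable def greenInverse (s t : ↥Hᶜ) : ℝ := (N.green H s t).toReal / N.total t

theorem isNonnegInverse_greenInverse [Nontrivial V] (hH : H.Nonempty) :
    IsNonnegInverse (N.laplacianMatrix.toBlock (· ∈ Hᶜ) (· ∈ Hᶜ)) (N.greenInverse H) where
  nonneg s t := div_nonneg ENNReal.toReal_nonneg (N.total_pos t).le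
  mul_right s t := by
    classical
    have h := ((hasSum_ite_eq s (N.green H s t).toReal).sub
      (N.hasSum_prob_mul_green H hH s t)).mul_left (N.total s / N.total t)
    refine h.of_real_eq (fun u => ?_) ?_
    · rw [laplacianMatrix_compl_apply, greenInverse]
      by_cases hu : u = s
      · subst hu; simp; ring
      · simp [hu, Ne.symm hu]; ring
    · by_cases hst : s = t
      · subst hst; simp [(N.total_pos (s : V)).ne']
      · simp [hst]
  mul_left s t := by
    classical
    have h := (hasSum_ite_eq t (N.green H s t).toReal).sub
      (N.hasSum_green_mul_prob H hH s t)
    refine h.of_real_eq (fun u => ?_) ?_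
    · have hu0 := (N.total_pos (u : V)).ne'
      rw [laplacianMatrix_compl_apply, greenInverse]
      by_cases hu : u = t
      · subst hu; simp; field_simp
      · simp [hu]; field_simp
    · by_cases hst : s = t
      · subst hst; simp
      · simp [hst]

/-- Scaling the columns of DG = I by c turns it into g = I + Qg with g = Gc, to which minimality of
the Green kernel applies. -/
theorem greenInverse_le [Nontrivial V] {G : ↥Hᶜ → ↥Hᶜ → ℝ}
    (hG : IsNonnegInverse (N.laplacianMatrix.toBlock (· ∈ Hᶜ) (· ∈ Hᶜ)) G) :
    N.greenInverse H ≤ G := by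
  classical
  intro s t
  have key : N.green H s t ≤ ENNReal.ofReal (G s t * N.total t) := by
    refine greenKernel_le _ (fun s t => ENNReal.ofReal (G s t * N.total t)) (fun s t => ?_) s t
    have h1 := (hasSum_ite_eq s (G s t * N.total t)).sub
      ((hG.mul_right s t).mul_left (N.total t / N.total s))
    have h2 : HasSum (fun u : ↥Hᶜ => N.prob s u * (G u t * N.total t))
        (G s t * N.total t - Set.indicator {t} 1 s) := by
      have hs0 := (N.total_pos (s : V)).ne'
      refine h1.of_real_eq (fun u => ?_) ?_
      · rw [laplacianMatrix_compl_apply]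
        by_cases hu : u = s
        · subst hu; simp; field_simp; ring
        · simp [hu, Ne.symm hu]; field_simp
      · by_cases hst : s = t
        · subst hst; simp [hs0]
        · simp [hst]
    have h0 : ∀ u : ↥Hᶜ, 0 ≤ N.prob s u * (G u t * N.total t) := fun u =>
      mul_nonneg (N.prob_nonneg _ _) (mul_nonneg (hG.nonneg u t) (N.total_pos t).le)
    have h3 : ∑' u : ↥Hᶜ, N.eprob s u * ENNReal.ofReal (G u t * N.total t) =
        ENNReal.ofReal (G s t * N.total t - Set.indicator {t} 1 s) := by
      rw [← h2.tsum_eq, ENNReal.ofReal_tsum_of_nonneg h0 h2.summable]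
      exact tsum_congr fun u => (ENNReal.ofReal_mul (N.prob_nonneg _ _)).symm
    have h4 : (Set.indicator {t} 1 s : ℝ≥0∞) = ENNReal.ofReal (Set.indicator {t} 1 s) := by
      by_cases hst : s = t <;> simp [hst]
    have hδ : (0 : ℝ) ≤ Set.indicator {t} 1 s := by
      by_cases hst : s = t <;> simp [hst]
    rw [h3, h4, ← ENNReal.ofReal_add hδ (h2.nonneg h0)]
    exact ENNReal.ofReal_le_ofReal (by linarith)
  rw [greenInverse, div_le_iff₀ (N.total_pos t)]
  exact ENNReal.toReal_le_of_le_ofReal (mul_nonneg (hG.nonneg s t) (N.total_pos t).le) key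

theorem isLeast_greenInverse [Nontrivial V] (hH : H.Nonempty) :
    IsLeast {G | IsNonnegInverse (N.laplacianMatrix.toBlock (· ∈ Hᶜ) (· ∈ Hᶜ)) G}
      (N.greenInverse H) :=
  ⟨N.isNonnegInverse_greenInverse H hH, fun _ hG => N.greenInverse_le H hG⟩

theorem _root_.minInverse_eq_of_isLeast {ι : Type*} {D G : ι → ι → ℝ}
    (h : IsLeast {G | IsNonnegInverse D G} G) : minInverse D = G := by
  have hex : ∃ G, IsLeast {G | IsNonnegInverse D G} G := ⟨G, h⟩
  rw [minInverse, dif_pos hex]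
  exact hex.choose_spec.unique h

theorem minInverse_eq_greenInverse [Nontrivial V] (hH : H.Nonempty) :
    minInverse (N.laplacianMatrix.toBlock (· ∈ Hᶜ) (· ∈ Hᶜ)) = N.greenInverse H :=
  minInverse_eq_of_isLeast (N.isLeast_greenInverse H hH)

/-! ### The Schur complement as a hitting probability. -/

theorem hasSum_schurComplement [Nontrivial V] [MeasurableSpace V] [DiscreteMeasurableSpace V]
    (hH : H.Nonempty) (x y : H) :
    HasSum (fun st : ↥Hᶜ × ↥Hᶜ =>
      N.laplacianMatrix x st.1 *
        minInverse (N.laplacianMatrix.toBlock (· ∈ Hᶜ) (· ∈ Hᶜ)) st.1 st.2 *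
        N.laplacianMatrix st.2 y)
      (N.total x * (N.walk (x : V)).real (pathsThroughCompl H (y : V))) := by
  have h := (ENNReal.hasSum_toReal_of_tsum_eq
    (N.walk_pathsThroughCompl_eq_green H y.2 x).symm (measure_ne_top _ _)).mul_left (N.total x)
  refine h.of_real_eq (fun ⟨s, t⟩ => ?_) rfl
  -- The signs of the two off-diagonal blocks cancel, and the 1/c(t) of the inverse is the
  -- denominator of p(t,y).
  rw [N.minInverse_eq_greenInverse H hH, greenInverse,
    N.laplacianMatrix_of_ne (fun h : (x : V) = s => s.2 (h ▸ x.2)),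
    N.laplacianMatrix_of_ne (fun h : (t : V) = y => t.2 (h ▸ y.2))]
  simp only [ENNReal.toReal_mul, toReal_eprob, prob]
  have hx := (N.total_pos (x : V)).ne'
  have ht := (N.total_pos (t : V)).ne'
  field_simp

theorem traceLaplacian_apply [Nontrivial V] [MeasurableSpace V] [DiscreteMeasurableSpace V]
    (hH : H.Nonempty) (x y : H) :
    N.traceLaplacian H x y = N.laplacianMatrix x y -
      N.total x * (N.walk (x : V)).real (pathsThroughCompl H (y : V)) := by
  rw [← (N.hasSum_schurComplement H hH x y).tsum_eq]
  rfl

theorem traceProb_eq [Nontrivial V] [MeasurableSpace V] [DiscreteMeasurableSpace V]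
    (hH : H.Nonempty) (x y : H) :
    N.traceProb H x y =
      N.prob x y + (N.walk (x : V)).real (pathsThroughCompl H (y : V)) := by
  classical
  have hx := (N.total_pos (x : V)).ne'
  rw [traceProb, N.traceLaplacian_apply H hH, laplacianMatrix_apply, prob]
  by_cases h : x = y
  · subst h; simp; field_simp; ring
  · simp [h, Subtype.coe_inj]; field_simp; ring

end Green

end ResistanceNetwork

theorem mainTheorem5 {V : Type*} [Nontrivial V] [MeasurableSpace V] [DiscreteMeasurableSpace V]
    (N : ResistanceNetwork V) (H : Set V) (hH : H.Nonempty) :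
    -- the inverse of the block `D` exists ...
    IsLeast {G | IsNonnegInverse (N.laplacianMatrix.toBlock (· ∈ Hᶜ) (· ∈ Hᶜ)) G}
      (minInverse (N.laplacianMatrix.toBlock (· ∈ Hᶜ) (· ∈ Hᶜ))) ∧
    -- ... and the series for the entries of `Bᵀ D⁻¹ B` converge absolutely
    (∀ x y : H, Summable fun st : ↥Hᶜ × ↥Hᶜ =>
      N.laplacianMatrix x st.1 *
        minInverse (N.laplacianMatrix.toBlock (· ∈ Hᶜ) (· ∈ Hᶜ)) st.1 st.2 *
        N.laplacianMatrix st.2 y) ∧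
    -- conductances of the trace network
    (∀ x y : H, x ≠ y →
      N.traceCond H x y =
        N.cond x y + N.total x * (N.walk (x : V)).real (pathsThroughCompl H (y : V))) ∧
    -- transition probabilities of the trace
    (∀ x y : H,
      N.traceProb H x y = N.prob x y + (N.walk (x : V)).real (pathsThroughCompl H (y : V))) ∧
    -- the same with the one-step path included in the event
    (∀ x y : H, N.traceProb H x y = (N.walk (x : V)).real (pathsAvoiding H (y : V))) := by
  refine ⟨?_, fun x y => (N.hasSum_schurComplement H hH x y).summable, fun x y hxy => ?_,
    N.traceProb_eq H hH, fun x y => ?_⟩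
  · rw [N.minInverse_eq_greenInverse H hH]
    exact N.isLeast_greenInverse H hH
  · rw [ResistanceNetwork.traceCond, if_neg hxy, N.traceLaplacian_apply H hH,
      N.laplacianMatrix_of_ne (Subtype.coe_injective.ne hxy)]
    ring
  · rw [N.traceProb_eq H hH, measureReal_def, measureReal_def, N.walk_pathsAvoiding_eq_add H y.2,
      ENNReal.toReal_add (by exact ENNReal.ofReal_ne_top) (measure_ne_top _ _), N.toReal_eprob]
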